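/- Let $K$ be an algebraically closed field and let $V$ be an algebraic group over $K$, i.e. a group object in the category of reduced $K$-schemes of finite type, which we identify with its set of $K$-points. For a finite set $E$, an algebraic subgroup of $V^E$ is an abstract subgroup that is closed for the Zariski topology of the product variety $V^E$. Let $G$ be a countable group. It acts on $V^G$ by $(gx)(h)=x(g^{-1}h)$ for $x\in V^G$ and $g,h\in G$. For $\Sigma\subset V^G$ and $E\subset G$, write $\Sigma_E=\{x|_E : x\in\Sigma\}\subset V^E$. An *algebraic group subshift* of $V^G$ is a $G$-invariant subset $\Sigma\subset V^G$ that is closed in the prodiscrete topology (the product topology where each factor $V$ is discrete) and such that $\Sigma_E$ is an algebraic subgroup of $V^E$ for every finite subset $E\subset G$. An *algebraic group subshift of finite type* of $V^G$ is a subset of the form $\{x\in V^G : (g^{-1}x)|_D\in W \text{ for all } g\in G\}$, where $D\subset G$ is a finite subset and $W\subset V^D$ is an algebraic subgroup. Then the following conditions are equivalent: (a) every algebraic group subshift of $V^G$ is an algebraic group subshift of finite type; (b) every descending sequence $\Sigma_0\supset\Sigma_1\supset\Sigma_2\supset\cdots$ of algebraic group subshifts of $V^G$ eventually stabilizes, i.e.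 there is $N\ge 0$ with $\Sigma_n=\Sigma_N$ for all $n\ge N$. -/

import Mathlib

open CategoryTheory AlgebraicGeometry

universe u v w

namespace AlgGroupSubshift

section Shift

variable {G : Type v} [Group G] {A : Type w}

/-- The shift action of `G` on configurations: `(g x)(h) = x (g⁻¹ h)`. -/
def shift (g : G) (x : G → A) : G → A := fun h => x (g⁻¹ * h)

/-- The restriction `X_E` to a finite set `E` of a set `X` of configurations. -/
def restrictSet (E : Finset G) (X : Set (G → A)) : Set (E → A) := E.restrict '' X

/-- The subshift of finite type defined by the finite window `D` and the patterns `P`. -/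
def sft (D : Finset G) (P : Set (D → A)) : Set (G → A) :=
  {x | ∀ g : G, D.restrict (shift g⁻¹ x) ∈ P}

/-- Closedness for the prodiscrete topology, the product of the discrete topologies on `A`. -/
def IsProdiscreteClosed (X : Set (G → A)) : Prop :=
  @IsClosed (G → A) (@Pi.topologicalSpace G (fun _ => A) (fun _ => ⊥)) X

end Shift

noncomputable section Algebraic

open scoped MonoidalCategory CartesianMonoidalCategory MonObj

variable {K : Type u} [Field K]

/-- The `K`-points of a `K`-scheme; they form a group when `V` is a group scheme over `K`
(by the instance `CategoryTheory.Hom.group`). -/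
abbrev Points (V : Over (Spec (.of K))) : Type u := 𝟙_ (Over (Spec (.of K))) ⟶ V

/-- The point of the underlying space of the power `V ^ J` (the product over `K`) that
corresponds to a family of `K`-points of `V`. -/
def powerPoint (V : Over (Spec (.of K))) (J : Type v) [Finite J] (x : J → Points V) :
    (∏ᶜ fun _ : J => V : Over (Spec (.of K))).left :=
  (Limits.Pi.lift x).left (IsLocalRing.closedPoint K)

/-- The Zariski topology on the `K`-points of the power `V ^ J`, identified with `V(K) ^ J`:
it is induced by the underlying topological space of the product scheme (it is not the product
of the Zariski topologies of the factors). -/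
abbrev zariskiTopology (V : Over (Spec (.of K))) (J : Type v) [Finite J] :
    TopologicalSpace (J → Points V) :=
  TopologicalSpace.induced (powerPoint V J) inferInstance

/-- Algebraic subgroups of `V ^ J`: Zariski closed abstract subgroups. -/
def IsAlgebraicSubgroup (V : Over (Spec (.of K))) [GrpObj V] (J : Type v) [Finite J]
    (S : Set (J → Points V)) : Prop :=
  (∃ H : Subgroup (J → Points V), (H : Set (J → Points V)) = S) ∧
    @IsClosed (J → Points V) (zariskiTopology V J) S

/-- Algebraic group subshifts of `V ^ G`. -/
structure IsAlgebraicGroupSubshift {G : Type v} [Group G] (V : Over (Spec (.of K))) [GrpObj V]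
    (X : Set (G → Points V)) : Prop where
  shift_mem : ∀ g : G, ∀ x ∈ X, shift g x ∈ X
  isProdiscreteClosed : IsProdiscreteClosed X
  isAlgebraicSubgroup_restrictSet : ∀ E : Finset G, IsAlgebraicSubgroup V E (restrictSet E X)

/-- Algebraic group subshifts of finite type of `V ^ G`. -/
def IsAlgebraicGroupSFT {G : Type v} [Group G] (V : Over (Spec (.of K))) [GrpObj V]
    (X : Set (G → Points V)) : Prop :=
  ∃ (D : Finset G) (W : Set (D → Points V)), IsAlgebraicSubgroup V D W ∧ X = sft D W

end Algebraic

end AlgGroupSubshift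

namespace AlgGroupSubshift

section Configurations

variable {G : Type v} {A : Type w}

/-- A countable type is exhausted by an increasing sequence of finite sets starting at any given
finite set. -/
theorem exists_exhaustion [Countable G] (E₀ : Finset G) :
    ∃ E : ℕ → Finset G, E 0 = E₀ ∧ Monotone E ∧ ∀ g, ∃ k, g ∈ E k := by
  classical
  obtain ⟨f, hf⟩ := Countable.exists_injective_nat G
  have hfin : ∀ n, {g | f g < n}.Finite := fun n =>
    (Set.finite_Iio n).preimage hf.injOn
  refine ⟨fun n => E₀ ∪ (hfin n).toFinset, ?_, ?_, fun g => ⟨f g + 1, ?_⟩⟩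
  · ext g
    simp
  · intro m n hmn g hg
    have hmn' : m ≤ n := hmn
    simp only [Finset.mem_union, Set.Finite.mem_toFinset, Set.mem_ofPred_eq] at hg ⊢
    exact hg.imp_right fun h => h.trans_le hmn'
  · simp

theorem subset_exhaustion {E : ℕ → Finset G} (hE : Monotone E) (hex : ∀ g, ∃ k, g ∈ E k)
    (F : Finset G) : ∃ k, F ⊆ E k := by
  classical
  induction F using Finset.induction_on with
  | empty => exact ⟨0, Finset.empty_subset _⟩
  | insert a s _ ih =>
    obtain ⟨k, hk⟩ := ih
    obtain ⟨l, hl⟩ := hex a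
    refine ⟨max k l, Finset.insert_subset (hE (le_max_right k l) hl) ?_⟩
    exact hk.trans (hE (le_max_left k l))

/-- A compatible sequence of patterns along an exhaustion glues to a configuration. -/
theorem exists_restrict_eq {E : ℕ → Finset G} (hE : Monotone E) (hex : ∀ g, ∃ k, g ∈ E k)
    (p : ∀ k, E k → A)
    (hp : ∀ k, Finset.restrict₂ (π := fun _ => A) (hE k.le_succ) (p (k + 1)) = p k) :
    ∃ x : G → A, ∀ k, (E k).restrict x = p k := by
  have hcompat : ∀ k l (g : G) (hk : g ∈ E k) (hl : g ∈ E l), k ≤ l → p l ⟨g, hl⟩ = p k ⟨g, hk⟩ := by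
    intro k l g hk hl hkl
    induction l, hkl using Nat.le_induction with
    | base => rfl
    | succ l hkl ih =>
      rw [← ih (hE hkl hk), ← hp l]
      rfl
  choose κ hκ using hex
  refine ⟨fun g => p (κ g) ⟨g, hκ g⟩, fun k => ?_⟩
  ext ⟨g, hg⟩
  rcases le_total k (κ g) with h | h
  · exact hcompat _ _ g hg (hκ g) h
  · exact (hcompat _ _ g (hκ g) hg h).symm

/-- The Mittag-Leffler argument: `Y n k` are sets of patterns on the `k`-th set of an exhaustion
which decrease and stabilize as `n` grows. If patterns can be extended at the cost of one step
in `n`, then every pattern in all the `Y n 0` extends to a configuration with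
all its patterns in all the `Y n k`. -/
theorem exists_restrict_mem {E : ℕ → Finset G} (hE : Monotone E) (hex : ∀ g, ∃ k, g ∈ E k)
    (Y : ℕ → ∀ k, Set (E k → A))
    (hanti : ∀ k, Antitone fun n => Y n k)
    (hstab : ∀ k, ∃ N, ∀ n, N ≤ n → Y n k = Y N k)
    (hlift : ∀ n k, ∀ y ∈ Y (n + 1) k, ∃ z ∈ Y n (k + 1),
      Finset.restrict₂ (π := fun _ => A) (hE k.le_succ) z = y)
    {y : E 0 → A} (hy : ∀ n, y ∈ Y n 0) :
    ∃ x : G → A, (E 0).restrict x = y ∧ ∀ n k, (E k).restrict x ∈ Y n k := by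
  have hlift' : ∀ k (y : {y : E k → A // ∀ n, y ∈ Y n k}),
      ∃ z : {z : E (k + 1) → A // ∀ n, z ∈ Y n (k + 1)},
        Finset.restrict₂ (π := fun _ => A) (hE k.le_succ) z.1 = y.1 := by
    rintro k ⟨y, hy⟩
    obtain ⟨N, hN⟩ := hstab (k + 1)
    obtain ⟨z, hz, hzy⟩ := hlift N k y (hy _)
    refine ⟨⟨z, fun n => ?_⟩, hzy⟩
    rcases le_total N n with h | h
    · rw [hN n h]
      exact hz
    · exact hanti (k + 1) h hz
  choose next hnext using hlift'
  let p : ∀ k, {y : E k → A // ∀ n, y ∈ Y n k} := fun k => Nat.rec ⟨y, hy⟩ (fun k q => next k q) k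
  obtain ⟨x, hx⟩ := exists_restrict_eq hE hex (fun k => (p k).1) fun k => hnext k (p k)
  refine ⟨x, hx 0, fun n k => ?_⟩
  rw [hx k]
  exact (p k).2 n

theorem restrictSet_mono (E : Finset G) {X Y : Set (G → A)} (h : X ⊆ Y) :
    restrictSet E X ⊆ restrictSet E Y :=
  Set.image_mono h

theorem IsProdiscreteClosed.mem_of_forall_restrict {X : Set (G → A)} (hX : IsProdiscreteClosed X)
    {x : G → A} (hx : ∀ E : Finset G, E.restrict x ∈ restrictSet E X) : x ∈ X := by
  let _ : TopologicalSpace A := ⊥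
  have hX' : IsClosed X := hX
  by_contra hxX
  obtain ⟨I, U, hU, hsub⟩ := isOpen_pi_iff.mp hX'.isOpen_compl x hxX
  obtain ⟨z, hz, hzx⟩ := hx I
  refine hsub (fun a ha => ?_) hz
  have : z a = x a := congrFun hzx ⟨a, ha⟩
  rw [this]
  exact (hU a ha).2

theorem IsProdiscreteClosed.iInter {ι : Type*} {X : ι → Set (G → A)}
    (hX : ∀ i, IsProdiscreteClosed (X i)) : IsProdiscreteClosed (⋂ i, X i) :=
  @isClosed_iInter _ _ (_) _ hX

variable [Group G]

theorem isProdiscreteClosed_sft (D : Finset G) (P : Set (D → A)) :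
    IsProdiscreteClosed (sft D P) := by
  let _ : TopologicalSpace A := ⊥
  have : DiscreteTopology A := ⟨rfl⟩
  have : sft D P = ⋂ g : G, (fun x : G → A => D.restrict (shift g⁻¹ x)) ⁻¹' P := by
    ext x
    simp [sft]
  change IsClosed (sft D P)
  rw [this]
  refine isClosed_iInter fun g => (isClosed_discrete P).preimage ?_
  exact continuous_pi fun d => continuous_apply _

theorem shift_mem_sft {D : Finset G} {P : Set (D → A)} (g : G) {x : G → A} (hx : x ∈ sft D P) :
    shift g x ∈ sft D P := by
  intro h
  have : shift h⁻¹ (shift g x) = shift (g⁻¹ * h)⁻¹ x := by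
    ext k
    simp [shift, mul_assoc]
  rw [this]
  exact hx _

/-- Subshifts lie in the subshift of finite type of their own patterns. -/
theorem subset_sft_restrictSet {X : Set (G → A)} (hX : ∀ g : G, ∀ x ∈ X, shift g x ∈ X)
    (D : Finset G) : X ⊆ sft D (restrictSet D X) :=
  fun x hx g => ⟨_, hX g⁻¹ x hx, rfl⟩

theorem sft_mono (D : Finset G) {P Q : Set (D → A)} (h : P ⊆ Q) : sft D P ⊆ sft D Q :=
  fun _ hx g => h (hx g)

theorem sft_restrictSet_anti {D F : Finset G} (h : D ⊆ F) (X : Set (G → A)) :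
    sft F (restrictSet F X) ⊆ sft D (restrictSet D X) := by
  intro x hx g
  obtain ⟨z, hz, hzx⟩ := hx g
  exact ⟨z, hz, funext fun d => congrFun hzx ⟨d, h d.2⟩⟩

theorem restrict_mem_of_mem_sft {D : Finset G} {P : Set (D → A)} {x : G → A} (hx : x ∈ sft D P) :
    D.restrict x ∈ P := by
  have h := hx 1
  have : shift (1 : G)⁻¹ x = x := by
    ext k
    simp [shift]
  rwa [this] at h

/-- The patterns on `F` that satisfy the constraints of `sft D P` visible in `F`. -/
def locallyAdmissible (D : Finset G) (P : Set (D → A)) (F : Finset G) : Set (F → A) :=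
  {p | ∀ (g : G) (h : ∀ d ∈ D, g * d ∈ F), (fun d : D => p ⟨g * d, h d d.2⟩) ∈ P}

theorem restrict_mem_locallyAdmissible {D : Finset G} {P : Set (D → A)} {x : G → A}
    (hx : x ∈ sft D P) (F : Finset G) : F.restrict x ∈ locallyAdmissible D P F := by
  intro g h
  convert hx g using 1
  ext d
  simp [shift]

theorem restrict₂_mem_locallyAdmissible {D : Finset G} {P : Set (D → A)} {F F' : Finset G}
    (h : F ⊆ F') {p : F' → A} (hp : p ∈ locallyAdmissible D P F') :
    Finset.restrict₂ (π := fun _ => A) h p ∈ locallyAdmissible D P F :=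
  fun g hg => hp g fun d hd => h (hg d hd)

theorem mem_sft_of_forall_restrict [DecidableEq G] {D : Finset G} {P : Set (D → A)}
    {E : ℕ → Finset G} (hE : Monotone E) (hex : ∀ g, ∃ k, g ∈ E k) {x : G → A}
    (hx : ∀ k, (E k).restrict x ∈ locallyAdmissible D P (E k)) : x ∈ sft D P := by
  intro g
  obtain ⟨k, hk⟩ := subset_exhaustion hE hex (D.image (g * ·))
  convert hx k g fun d hd => hk (Finset.mem_image_of_mem _ hd) using 1
  ext d
  simp [shift]

end Configurations

section Topology

/-- A constructible set contains or misses a nonempty open piece of every nonempty locally closed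
set. -/
theorem _root_.Topology.IsConstructible.exists_isOpen_inter_subset_or {T : Type*}
    [TopologicalSpace T] {s : Set T} (hs : Topology.IsConstructible s) (Z : Set T) {O : Set T}
    (hO : IsOpen O) (hne : (O ∩ Z).Nonempty) :
    ∃ O' ⊆ O, IsOpen O' ∧ (O' ∩ Z).Nonempty ∧ (O' ∩ Z ⊆ s ∨ O' ∩ Z ⊆ sᶜ) := by
  induction hs using Topology.IsConstructible.empty_union_induction generalizing O with
  | open_retrocompact U hU _ =>
    by_cases h : (O ∩ U ∩ Z).Nonempty
    · exact ⟨O ∩ U, Set.inter_subset_left, hO.inter hU, h, .inl fun x hx => hx.1.2⟩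
    · exact ⟨O, subset_rfl, hO, hne, .inr fun x hx hxU => h ⟨x, ⟨hx.1, hxU⟩, hx.2⟩⟩
  | union s _ t _ ihs iht =>
    obtain ⟨O₁, hO₁O, hO₁, hne₁, h | h⟩ := ihs hO hne
    · exact ⟨O₁, hO₁O, hO₁, hne₁, .inl (h.trans Set.subset_union_left)⟩
    obtain ⟨O₂, hO₂O, hO₂, hne₂, h' | h'⟩ := iht hO₁ hne₁
    · exact ⟨O₂, hO₂O.trans hO₁O, hO₂, hne₂, .inl (h'.trans Set.subset_union_right)⟩
    · refine ⟨O₂, hO₂O.trans hO₁O, hO₂, hne₂, .inr fun x hx => ?_⟩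
      rw [Set.compl_union]
      exact ⟨h ⟨hO₂O hx.1, hx.2⟩, h' hx⟩
  | compl s _ ih =>
    obtain ⟨O', h1, h2, h3, h4⟩ := ih hO hne
    exact ⟨O', h1, h2, h3, by rwa [compl_compl, or_comm]⟩

/-- A nonempty constructible set contains a nonempty open subset of its closure. -/
theorem _root_.Topology.IsConstructible.exists_isOpen_inter_closure_subset {T : Type*}
    [TopologicalSpace T] {s : Set T} (hs : Topology.IsConstructible s) (hne : s.Nonempty) :
    ∃ O, IsOpen O ∧ (O ∩ closure s).Nonempty ∧ O ∩ closure s ⊆ s := by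
  obtain ⟨O, -, hO, hne', h | h⟩ := hs.exists_isOpen_inter_subset_or (closure s) isOpen_univ
    (by simpa using hne)
  · exact ⟨O, hO, hne', h⟩
  · obtain ⟨x, hxO, hx⟩ := hne'
    obtain ⟨y, hyO, hy⟩ := mem_closure_iff.mp hx O hO hxO
    exact absurd hy (h ⟨hyO, subset_closure hy⟩)

/-- Let a group carry a topology with continuous translations and inversion. A subgroup containing
a nonempty open subset of its closure is closed. -/
theorem _root_.Subgroup.isClosed_of_exists_isOpen_inter_closure {A : Type*} [Group A]
    [TopologicalSpace A] (hl : ∀ a : A, Continuous fun x => a * x)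
    (hr : ∀ a : A, Continuous fun x => x * a) (hinv : Continuous fun x : A => x⁻¹)
    (S : Subgroup A) {O : Set A} (hO : IsOpen O) (hne : (O ∩ closure (S : Set A)).Nonempty)
    (hsub : O ∩ closure (S : Set A) ⊆ S) : IsClosed (S : Set A) := by
  have hSl : ∀ s ∈ S, ∀ t ∈ closure (S : Set A), s * t ∈ closure (S : Set A) := fun s hs t ht =>
    map_mem_closure (hl s) ht fun x hx => S.mul_mem hs hx
  have hmul : ∀ s ∈ closure (S : Set A), ∀ t ∈ closure (S : Set A),
      s * t ∈ closure (S : Set A) := fun s hs t ht => by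
    have := map_mem_closure (t := closure (S : Set A)) (hr t) hs fun x hx => hSl x hx t ht
    rwa [closure_closure] at this
  have hinv' : ∀ s ∈ closure (S : Set A), s⁻¹ ∈ closure (S : Set A) := fun s hs =>
    map_mem_closure hinv hs fun x hx => S.inv_mem hx
  refine isClosed_of_closure_subset fun t ht => ?_
  obtain ⟨u, hu⟩ := hne
  -- `t` lies in the open set `{x | u * t⁻¹ * x ∈ O}`, which therefore meets `S`.
  obtain ⟨x, hxO, hxS⟩ := mem_closure_iff.mp ht _ (hO.preimage (hl (u * t⁻¹)))
    (by simpa using hu.1)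
  have h1 : u * t⁻¹ * x ∈ S :=
    hsub ⟨hxO, hmul _ (hmul _ hu.2 _ (hinv' _ ht)) _ (subset_closure hxS)⟩
  have h2 : t = (u * t⁻¹ * x * x⁻¹)⁻¹ * u := by group
  change t ∈ S
  rw [h2]
  exact S.mul_mem (S.inv_mem (S.mul_mem h1 (S.inv_mem hxS))) (hsub hu)

end Topology

end AlgGroupSubshift

namespace AlgGroupSubshift

section FiniteProducts

open Limits MonoidalCategory CartesianMonoidalCategory

/-- The `S`-objects whose structure map has a property stable under composition and base change are
closed under finite products. -/
theorem isClosedUnderFiniteProducts_overObj {C : Type u} [Category.{v} C] [HasPullbacks C]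
    (W : MorphismProperty C) [W.IsMultiplicative] [W.IsStableUnderBaseChange]
    (S : C) [HasFiniteProducts (Over S)] :
    (W.overObj (X := S)).IsClosedUnderFiniteProducts := by
  let _ := Over.cartesianMonoidalCategory S
  have : (W.overObj (X := S)).IsClosedUnderLimitsOfShape (Discrete.{0} PEmpty) :=
    Over.closedUnderLimitsOfShape_discrete_empty W
  have : (W.overObj (X := S)).IsClosedUnderBinaryProducts := by
    refine .mk' ?_
    rintro _ ⟨F, hF⟩
    let A := F.obj ⟨.left⟩
    let B := F.obj ⟨.right⟩
    let e : A ⊗ B ≅ limit F :=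
      (tensorProductIsBinaryProduct A B).conePointUniqueUpToIso (limit.isLimit (pair A B)) ≪≫
        (HasLimit.isoOfNatIso (diagramIsoPair F)).symm
    refine (W.overObj (X := S)).prop_of_iso e ?_
    exact W.comp_mem _ _ (W.pullback_fst _ _ (hF _)) (hF _)
  exact .mk'

end FiniteProducts

noncomputable section Algebraic

open scoped MonoidalCategory CartesianMonoidalCategory MonObj
open Limits

variable {K : Type u} [Field K]

section Power

variable (V : Over (Spec (.of K)))

/-- The power `V ^ J` as a product over the base. -/
abbrev power (J : Type v) [Finite J] : Over (Spec (.of K)) := ∏ᶜ fun _ : J => V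

theorem locallyOfFiniteType_power [LocallyOfFiniteType V.hom] (J : Type v) [Finite J] :
    LocallyOfFiniteType (power V J).hom := by
  have := isClosedUnderFiniteProducts_overObj @LocallyOfFiniteType (Spec (.of K))
  exact ObjectProperty.prop_product (P := MorphismProperty.overObj @LocallyOfFiniteType)
    fun _ => ‹LocallyOfFiniteType V.hom›

theorem quasiCompact_power [QuasiCompact V.hom] (J : Type v) [Finite J] :
    QuasiCompact (power V J).hom := by
  have := isClosedUnderFiniteProducts_overObj @QuasiCompact (Spec (.of K))
  exact ObjectProperty.prop_product (P := MorphismProperty.overObj @QuasiCompact)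
    fun _ => ‹QuasiCompact V.hom›

theorem isNoetherian_power [LocallyOfFiniteType V.hom] [QuasiCompact V.hom] (J : Type v)
    [Finite J] : IsNoetherian (power V J).left := by
  have := locallyOfFiniteType_power V J
  have := quasiCompact_power V J
  have : IsLocallyNoetherian (power V J).left :=
    LocallyOfFiniteType.isLocallyNoetherian (Y := Spec (.of K)) (power V J).hom
  have : CompactSpace (power V J).left :=
    QuasiCompact.compactSpace_of_compactSpace (Y := Spec (.of K)) (power V J).hom
  exact ⟨⟩

theorem powerPoint_comp {I J : Type v} [Finite I] [Finite J] (F : power V J ⟶ power V I)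
    {φ : (J → Points V) → I → Points V}
    (hF : ∀ x i, φ x i = Pi.lift x ≫ F ≫ Pi.π _ i) (x : J → Points V) :
    powerPoint V I (φ x) = F.left (powerPoint V J x) := by
  have : Pi.lift (φ x) = Pi.lift x ≫ F := by
    ext i
    simp [hF]
  rw [powerPoint, this]
  rfl

theorem continuous_of_comp {I J : Type v} [Finite I] [Finite J] (F : power V J ⟶ power V I)
    {φ : (J → Points V) → I → Points V}
    (hF : ∀ x i, φ x i = Pi.lift x ≫ F ≫ Pi.π _ i) :
    @Continuous _ _ (zariskiTopology V J) (zariskiTopology V I) φ := by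
  let _ := zariskiTopology V J
  rw [continuous_induced_rng]
  have : powerPoint V I ∘ φ = F.left ∘ powerPoint V J := funext (powerPoint_comp V F hF)
  rw [this]
  exact F.left.continuous.comp continuous_induced_dom

/-- Reindexing of the factors, as a morphism. -/
def reindex {I J : Type v} [Finite I] [Finite J] (f : I → J) : power V J ⟶ power V I :=
  Pi.lift fun i => Pi.π _ (f i)

theorem lift_reindex {I J : Type v} [Finite I] [Finite J] (f : I → J) (x : J → Points V) (i : I) :
    (x ∘ f) i = Pi.lift x ≫ reindex V f ≫ Pi.π _ i := by
  simp [reindex]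

theorem continuous_comp_reindex {I J : Type v} [Finite I] [Finite J] (f : I → J) :
    @Continuous _ _ (zariskiTopology V J) (zariskiTopology V I) fun x => x ∘ f :=
  continuous_of_comp V (reindex V f) (lift_reindex V f)

theorem noetherianSpace_zariskiTopology [LocallyOfFiniteType V.hom] [QuasiCompact V.hom]
    (J : Type v) [Finite J] :
    @TopologicalSpace.NoetherianSpace (J → Points V) (zariskiTopology V J) := by
  have := isNoetherian_power V J
  let _ := zariskiTopology V J
  exact Topology.IsInducing.noetherianSpace (i := powerPoint V J) ⟨rfl⟩

variable [IsAlgClosed K]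

theorem powerPoint_injective [LocallyOfFiniteType V.hom] (J : Type v) [Finite J] :
    Function.Injective (powerPoint V J) := by
  intro x y hxy
  have := locallyOfFiniteType_power V J
  have h : Pi.lift (f := fun _ : J => V) x = Pi.lift y := by
    refine Over.OverMorphism.ext ?_
    refine ext_of_apply_closedPoint_eq (power V J).hom ?_ ?_ hxy
    · exact Over.w (Pi.lift (f := fun _ : J => V) x)
    · exact Over.w (Pi.lift (f := fun _ : J => V) y)
  funext j
  simpa using congr($h ≫ Pi.π _ j)

theorem range_powerPoint [LocallyOfFiniteType V.hom] (J : Type v) [Finite J] :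
    Set.range (powerPoint V J) = closedPoints (power V J).left := by
  have := locallyOfFiniteType_power V J
  ext y
  constructor
  · rintro ⟨x, rfl⟩
    exact (pointEquivClosedPoint (power V J).hom
      ⟨(Pi.lift (f := fun _ : J => V) x).left, Over.w (Pi.lift (f := fun _ : J => V) x)⟩).2
  · intro hy
    let p : 𝟙_ (Over (Spec (.of K))) ⟶ power V J :=
      Over.homMk (pointOfClosedPoint (power V J).hom y hy) (pointOfClosedPoint_comp _ _ _)
    refine ⟨fun j => p ≫ Pi.π _ j, ?_⟩
    have : Pi.lift (fun j => p ≫ Pi.π _ j) = p := by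
      ext j
      simp
    rw [powerPoint, this]
    exact pointOfClosedPoint_apply (power V J).hom y hy _

end Power

/-- The image of a nonempty Zariski closed set under a morphism of powers contains
a nonempty open subset of its closure. -/
theorem exists_isOpen_inter_closure_image_subset [IsAlgClosed K] (V : Over (Spec (.of K)))
    [LocallyOfFiniteType V.hom] [QuasiCompact V.hom]
    {I J : Type v} [Finite I] [Finite J] (F : power V J ⟶ power V I)
    {φ : (J → Points V) → I → Points V}
    (hF : ∀ x i, φ x i = Pi.lift x ≫ F ≫ Pi.π _ i) {Z : Set (J → Points V)} (hne : Z.Nonempty)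
    (hZ : @IsClosed _ (zariskiTopology V J) Z) :
    ∃ O, @IsOpen _ (zariskiTopology V I) O ∧
      (O ∩ @closure _ (zariskiTopology V I) (φ '' Z)).Nonempty ∧
      O ∩ @closure _ (zariskiTopology V I) (φ '' Z) ⊆ φ '' Z := by
  have := locallyOfFiniteType_power V I
  have := locallyOfFiniteType_power V J
  have := isNoetherian_power V I
  have := isNoetherian_power V J
  have : JacobsonSpace (power V I).left :=
    LocallyOfFiniteType.jacobsonSpace (Y := Spec (.of K)) (power V I).hom
  have : JacobsonSpace (power V J).left :=
    LocallyOfFiniteType.jacobsonSpace (Y := Spec (.of K)) (power V J).hom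
  have : LocallyOfFiniteType (F.left ≫ (power V I).hom) := by
    rw [Over.w F]
    infer_instance
  have : LocallyOfFiniteType F.left :=
    locallyOfFiniteType_of_comp F.left (power V I).hom
  let _ := zariskiTopology V J
  let _ := zariskiTopology V I
  obtain ⟨C, hC, rfl⟩ := isClosed_induced_iff.mp hZ
  have hcons : Topology.IsConstructible (F.left '' C) := by
    refine F.left.isConstructible_image ?_
    rw [← compl_compl C, Topology.isConstructible_compl]
    exact (TopologicalSpace.NoetherianSpace.isCompact _).isConstructible hC.isOpen_compl
  -- The closed points of the image of `C` are the images of the closed points of `C`.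
  have himage : φ '' (powerPoint V J ⁻¹' C) = powerPoint V I ⁻¹' (F.left '' C) := by
    ext y
    constructor
    · rintro ⟨x, hx, rfl⟩
      exact ⟨_, hx, (powerPoint_comp V F hF x).symm⟩
    · rintro ⟨c, hc, hcy⟩
      have hy : IsClosed {powerPoint V I y} := by
        have : powerPoint V I y ∈ closedPoints (power V I).left := by
          rw [← range_powerPoint]
          exact ⟨y, rfl⟩
        exact this
      obtain ⟨z, ⟨hzC, hzy⟩, hz⟩ := nonempty_inter_closedPoints
        (Z := C ∩ F.left ⁻¹' {powerPoint V I y}) ⟨c, hc, hcy⟩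
        (hC.inter (hy.preimage F.left.continuous)).isLocallyClosed
      rw [← range_powerPoint] at hz
      obtain ⟨x, rfl⟩ := hz
      refine ⟨x, hzC, powerPoint_injective V I ?_⟩
      rw [powerPoint_comp V F hF x]
      exact hzy
  have hne' : (F.left '' C).Nonempty := by
    obtain ⟨x, hx⟩ := hne
    exact ⟨_, _, hx, rfl⟩
  obtain ⟨O, hO, hOne, hOsub⟩ := hcons.exists_isOpen_inter_closure_subset hne'
  have hcont : Continuous (powerPoint V I) := continuous_induced_dom
  refine ⟨powerPoint V I ⁻¹' O, hO.preimage hcont, ?_, ?_⟩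
  · obtain ⟨z, ⟨hzO, hzT⟩, hz⟩ := nonempty_inter_closedPoints hOne
      (hO.isLocallyClosed.inter isClosed_closure.isLocallyClosed)
    rw [← range_powerPoint] at hz
    obtain ⟨y, rfl⟩ := hz
    refine ⟨y, hzO, subset_closure ?_⟩
    rw [himage]
    exact hOsub ⟨hzO, hzT⟩
  · rintro y ⟨hyO, hy⟩
    rw [himage] at hy ⊢
    exact hOsub ⟨hyO, closure_mono (Set.image_preimage_subset _ _)
      (image_closure_subset_closure_image hcont ⟨y, hy, rfl⟩)⟩

section Group

variable (V : Over (Spec (.of K))) [GrpObj V]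

theorem continuous_mul_left_zariski {J : Type v} [Finite J] (a : J → Points V) :
    @Continuous _ _ (zariskiTopology V J) (zariskiTopology V J) fun x => a * x := by
  refine continuous_of_comp V
    (Pi.lift fun j => (CartesianMonoidalCategory.toUnit _ ≫ a j) * Pi.π (fun _ : J => V) j) fun x i => ?_
  simp [MonObj.comp_mul, CartesianMonoidalCategory.toUnit_unique _ (𝟙 _)]

theorem continuous_mul_right_zariski {J : Type v} [Finite J] (a : J → Points V) :
    @Continuous _ _ (zariskiTopology V J) (zariskiTopology V J) fun x => x * a := by
  refine continuous_of_comp V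
    (Pi.lift fun j => Pi.π (fun _ : J => V) j * (CartesianMonoidalCategory.toUnit _ ≫ a j)) fun x i => ?_
  simp [MonObj.comp_mul, CartesianMonoidalCategory.toUnit_unique _ (𝟙 _)]

theorem continuous_inv_zariski (J : Type v) [Finite J] :
    @Continuous (J → Points V) _ (zariskiTopology V J) (zariskiTopology V J) fun x => x⁻¹ := by
  refine continuous_of_comp V (Pi.lift fun j => (Pi.π (fun _ : J => V) j)⁻¹) fun x i => ?_
  simp [GrpObj.comp_inv]

/-- Reindexing of families of points, as a group homomorphism. -/
def reindexHom {I J : Type v} (f : I → J) : (J → Points V) →* (I → Points V) where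
  toFun x := x ∘ f
  map_one' := rfl
  map_mul' _ _ := rfl

variable {V}

theorem IsAlgebraicSubgroup.preimage_comp {I J : Type v} [Finite I] [Finite J]
    {S : Set (I → Points V)} (hS : IsAlgebraicSubgroup V I S) (f : I → J) :
    IsAlgebraicSubgroup V J ((fun x => x ∘ f) ⁻¹' S) := by
  obtain ⟨⟨H, rfl⟩, hcl⟩ := hS
  exact ⟨⟨H.comap (reindexHom V f), rfl⟩,
    @IsClosed.preimage _ _ (zariskiTopology V J) (zariskiTopology V I) _
      (continuous_comp_reindex V f) _ hcl⟩

theorem IsAlgebraicSubgroup.iInter {J : Type v} [Finite J] {κ : Type*}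
    {S : κ → Set (J → Points V)} (hS : ∀ i, IsAlgebraicSubgroup V J (S i)) :
    IsAlgebraicSubgroup V J (⋂ i, S i) := by
  choose H hH using fun i => (hS i).1
  refine ⟨⟨⨅ i, H i, ?_⟩, @isClosed_iInter _ _ (zariskiTopology V J) _ fun i => (hS i).2⟩
  rw [Subgroup.coe_iInf]
  exact Set.iInter_congr hH

theorem IsAlgebraicSubgroup.image_comp [IsAlgClosed K] [LocallyOfFiniteType V.hom]
    [QuasiCompact V.hom] {I J : Type v} [Finite I] [Finite J]
    {S : Set (J → Points V)} (hS : IsAlgebraicSubgroup V J S) (f : I → J) :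
    IsAlgebraicSubgroup V I ((fun x => x ∘ f) '' S) := by
  obtain ⟨⟨H, rfl⟩, hcl⟩ := hS
  refine ⟨⟨H.map (reindexHom V f), rfl⟩, ?_⟩
  obtain ⟨O, hO, hne, hsub⟩ := exists_isOpen_inter_closure_image_subset V (reindex V f)
    (lift_reindex V f) ⟨1, H.one_mem⟩ hcl
  exact @Subgroup.isClosed_of_exists_isOpen_inter_closure _ _ (zariskiTopology V I)
    (continuous_mul_left_zariski V) (continuous_mul_right_zariski V) (continuous_inv_zariski V I)
    (H.map (reindexHom V f)) O hO hne hsub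

/-- Descending sequences of algebraic subgroups stabilize. -/
theorem IsAlgebraicSubgroup.exists_stable [LocallyOfFiniteType V.hom] [QuasiCompact V.hom]
    {J : Type v} [Finite J] {S : ℕ → Set (J → Points V)}
    (hS : ∀ n, IsAlgebraicSubgroup V J (S n)) (hanti : Antitone S) :
    ∃ N, ∀ n, N ≤ n → S n = S N := by
  let _ := zariskiTopology V J
  have := noetherianSpace_zariskiTopology V J
  obtain ⟨N, hN⟩ := WellFoundedGT.monotone_chain_condition
    (α := (TopologicalSpace.Closeds (J → Points V))ᵒᵈ)
    ⟨fun n => OrderDual.toDual ⟨S n, (hS n).2⟩, fun m n h => hanti h⟩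
  exact ⟨N, fun n hn => (congrArg (fun C : (TopologicalSpace.Closeds (J → Points V))ᵒᵈ =>
    (OrderDual.ofDual C).carrier) (hN n hn)).symm⟩

end Group

end Algebraic

end AlgGroupSubshift

namespace AlgGroupSubshift

section Subshifts

variable {G : Type v} [Group G] {K : Type u} [Field K] {V : Over (Spec (.of K))} [GrpObj V]

theorem IsAlgebraicGroupSFT.of_window {X : Set (G → Points V)} (hX : IsAlgebraicGroupSubshift V X)
    (D : Finset G) (h : sft D (restrictSet D X) ⊆ X) : IsAlgebraicGroupSFT V X :=
  ⟨D, restrictSet D X, hX.isAlgebraicSubgroup_restrictSet D,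
    (subset_sft_restrictSet hX.shift_mem D).antisymm h⟩

theorem isAlgebraicSubgroup_locallyAdmissible {D : Finset G} {W : Set (D → Points V)}
    (hW : IsAlgebraicSubgroup V D W) (F : Finset G) :
    IsAlgebraicSubgroup V F (locallyAdmissible D W F) := by
  have : locallyAdmissible D W F = ⋂ g : {g : G // ∀ d ∈ D, g * d ∈ F},
      (fun p : F → Points V => p ∘ fun d : D => (⟨g.1 * d, g.2 d d.2⟩ : F)) ⁻¹' W := by
    ext p
    simp only [locallyAdmissible, Set.mem_ofPred_eq, Set.mem_iInter, Subtype.forall]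
    rfl
  rw [this]
  exact .iInter fun g => hW.preimage_comp _

variable [Countable G] [LocallyOfFiniteType V.hom] [QuasiCompact V.hom]

/-- Restriction to finite sets commutes with descending intersections. -/
theorem restrictSet_iInter {X : ℕ → Set (G → Points V)}
    (hX : ∀ n, IsAlgebraicGroupSubshift V (X n)) (hanti : Antitone X) (E : Finset G) :
    restrictSet E (⋂ n, X n) = ⋂ n, restrictSet E (X n) := by
  refine (Set.subset_iInter fun n => restrictSet_mono E (Set.iInter_subset X n)).antisymm ?_
  intro y hy
  obtain ⟨E, rfl, hE, hex⟩ := exists_exhaustion E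
  obtain ⟨x, hxy, hx⟩ := exists_restrict_mem hE hex (fun n k => restrictSet (E k) (X n))
    (fun k m n h => restrictSet_mono _ (hanti h))
    (fun k => IsAlgebraicSubgroup.exists_stable
      (fun n => (hX n).isAlgebraicSubgroup_restrictSet (E k))
      fun m n h => restrictSet_mono _ (hanti h))
    (by
      rintro n k _ ⟨x, hx, rfl⟩
      exact ⟨_, ⟨x, hanti n.le_succ hx, rfl⟩, rfl⟩)
    (Set.mem_iInter.mp hy)
  refine ⟨x, Set.mem_iInter.mpr fun n => ?_, hxy⟩
  refine (hX n).isProdiscreteClosed.mem_of_forall_restrict fun F => ?_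
  obtain ⟨k, hk⟩ := subset_exhaustion hE hex F
  obtain ⟨z, hz, hzx⟩ := hx n k
  exact ⟨z, hz, funext fun g => congrFun hzx ⟨g, hk g.2⟩⟩

theorem IsAlgebraicGroupSubshift.iInter {X : ℕ → Set (G → Points V)}
    (hX : ∀ n, IsAlgebraicGroupSubshift V (X n)) (hanti : Antitone X) :
    IsAlgebraicGroupSubshift V (⋂ n, X n) where
  shift_mem g _ hx := Set.mem_iInter.mpr fun n => (hX n).shift_mem g _ (Set.mem_iInter.mp hx n)
  isProdiscreteClosed := .iInter fun n => (hX n).isProdiscreteClosed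
  isAlgebraicSubgroup_restrictSet E := by
    rw [restrictSet_iInter hX hanti]
    exact .iInter fun n => (hX n).isAlgebraicSubgroup_restrictSet E

/-- Algebraic group subshifts of finite type are algebraic group subshifts. -/
theorem IsAlgebraicGroupSFT.isAlgebraicGroupSubshift [IsAlgClosed K] {X : Set (G → Points V)}
    (hX : IsAlgebraicGroupSFT V X) : IsAlgebraicGroupSubshift V X := by
  classical
  obtain ⟨D, W, hW, rfl⟩ := hX
  refine ⟨fun g x hx => shift_mem_sft g hx, isProdiscreteClosed_sft D W, fun E => ?_⟩
  obtain ⟨E, rfl, hE, hex⟩ := exists_exhaustion E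
  let Y : ℕ → ∀ k, Set (E k → Points V) := fun n k =>
    Finset.restrict₂ (π := fun _ => Points V) (hE (Nat.le_add_right k n)) ''
      locallyAdmissible D W (E (k + n))
  have hY : ∀ n k, IsAlgebraicSubgroup V (E k) (Y n k) := fun n k =>
    (isAlgebraicSubgroup_locallyAdmissible hW _).image_comp
      fun g : E k => (⟨g, hE (Nat.le_add_right k n) g.2⟩ : E (k + n))
  have hanti : ∀ k, Antitone fun n => Y n k := by
    rintro k m n h _ ⟨p, hp, rfl⟩
    exact ⟨_, restrict₂_mem_locallyAdmissible (hE (Nat.add_le_add_left h k)) hp, rfl⟩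
  have hlift : ∀ n k, ∀ y ∈ Y (n + 1) k, ∃ z ∈ Y n (k + 1),
      Finset.restrict₂ (π := fun _ => Points V) (hE k.le_succ) z = y := by
    rintro n k _ ⟨p, hp, rfl⟩
    have h : k + 1 + n ≤ k + (n + 1) := by omega
    exact ⟨_, ⟨_, restrict₂_mem_locallyAdmissible (hE h) hp, rfl⟩, rfl⟩
  have hrestrict : restrictSet (E 0) (sft D W) = ⋂ n, Y n 0 := by
    refine Set.Subset.antisymm ?_ fun y hy => ?_
    · rintro _ ⟨x, hx, rfl⟩
      exact Set.mem_iInter.mpr fun n => ⟨_, restrict_mem_locallyAdmissible hx _, rfl⟩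
    · obtain ⟨x, hxy, hx⟩ := exists_restrict_mem hE hex Y hanti
        (fun k => IsAlgebraicSubgroup.exists_stable (fun n => hY n k) (hanti k)) hlift
        (Set.mem_iInter.mp hy)
      refine ⟨x, mem_sft_of_forall_restrict hE hex fun k => ?_, hxy⟩
      obtain ⟨p, hp, hpx⟩ := hx 0 k
      rw [← hpx]
      exact hp
  rw [hrestrict]
  exact .iInter fun n => hY n 0

/-- A descending sequence of algebraic group subshifts whose intersection is of finite type
stabilizes. -/
theorem IsAlgebraicGroupSFT.exists_stable {X : ℕ → Set (G → Points V)}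
    (hX : ∀ n, IsAlgebraicGroupSubshift V (X n)) (hanti : Antitone X)
    (h : IsAlgebraicGroupSFT V (⋂ n, X n)) : ∃ N, ∀ n, N ≤ n → X n = X N := by
  obtain ⟨D, W, -, hDW⟩ := h
  obtain ⟨N, hN⟩ := IsAlgebraicSubgroup.exists_stable
    (fun n => (hX n).isAlgebraicSubgroup_restrictSet D) fun m n h => restrictSet_mono D (hanti h)
  have hND : restrictSet D (X N) ⊆ W := by
    have h1 : restrictSet D (X N) ⊆ restrictSet D (⋂ n, X n) := by
      rw [restrictSet_iInter hX hanti]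
      refine Set.subset_iInter fun n => ?_
      rcases le_total N n with h | h
      · exact (hN n h).ge
      · exact restrictSet_mono D (hanti h)
    refine h1.trans ?_
    rw [hDW]
    rintro _ ⟨x, hx, rfl⟩
    exact restrict_mem_of_mem_sft hx
  have hXN : X N ⊆ ⋂ n, X n := by
    rw [hDW]
    exact (subset_sft_restrictSet (hX N).shift_mem D).trans (sft_mono D hND)
  exact ⟨N, fun n hn => (hanti hn).antisymm (hXN.trans (Set.iInter_subset X n))⟩

/-- If descending sequences of algebraic group subshifts stabilize, then algebraic group subshifts
are of finite type. -/
theorem IsAlgebraicGroupSubshift.isAlgebraicGroupSFT_of_stable [IsAlgClosed K]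
    (hdcc : ∀ X : ℕ → Set (G → Points V), (∀ n, IsAlgebraicGroupSubshift V (X n)) →
      (∀ n, X (n + 1) ⊆ X n) → ∃ N, ∀ n, N ≤ n → X n = X N)
    {X : Set (G → Points V)} (hX : IsAlgebraicGroupSubshift V X) : IsAlgebraicGroupSFT V X := by
  obtain ⟨E, -, hE, hex⟩ := exists_exhaustion (∅ : Finset G)
  have hanti : Antitone fun n => sft (E n) (restrictSet (E n) X) :=
    fun m n h => sft_restrictSet_anti (hE h) X
  obtain ⟨N, hN⟩ := hdcc (fun n => sft (E n) (restrictSet (E n) X))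
    (fun n => IsAlgebraicGroupSFT.isAlgebraicGroupSubshift
      ⟨E n, _, hX.isAlgebraicSubgroup_restrictSet (E n), rfl⟩)
    fun n => hanti n.le_succ
  refine .of_window hX (E N) fun x hx => hX.isProdiscreteClosed.mem_of_forall_restrict fun F => ?_
  obtain ⟨k, hk⟩ := subset_exhaustion hE hex F
  have hxk : x ∈ sft (E k) (restrictSet (E k) X) := by
    rcases le_total N k with h | h
    · exact (hN k h).ge hx
    · exact hanti h hx
  obtain ⟨z, hz, hzx⟩ := restrict_mem_of_mem_sft hxk
  exact ⟨z, hz, funext fun g => congrFun hzx ⟨g, hk g.2⟩⟩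

end Subshifts

end AlgGroupSubshift

theorem propositionc {G : Type v} [Group G] [Countable G]
    {K : Type u} [Field K] [IsAlgClosed K]
    (V : Over (Spec (.of K))) [GrpObj V]
    [IsReduced V.left] [LocallyOfFiniteType V.hom] [QuasiCompact V.hom] :
    (∀ X : Set (G → AlgGroupSubshift.Points V),
        AlgGroupSubshift.IsAlgebraicGroupSubshift V X →
          AlgGroupSubshift.IsAlgebraicGroupSFT V X) ↔
      (∀ X : ℕ → Set (G → AlgGroupSubshift.Points V),
        (∀ n, AlgGroupSubshift.IsAlgebraicGroupSubshift V (X n)) →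
        (∀ n, X (n + 1) ⊆ X n) →
          ∃ N, ∀ n, N ≤ n → X n = X N) := by
  refine ⟨fun h X hX hsub => ?_, fun h X hX => hX.isAlgebraicGroupSFT_of_stable h⟩
  have hanti : Antitone X := antitone_nat_of_succ_le hsub
  exact AlgGroupSubshift.IsAlgebraicGroupSFT.exists_stable hX hanti (h _ (.iInter hX hanti))
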